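/- Let $G$ be a torsion-free hyperbolic group, that is, a group without nontrivial elements of finite order which has a finite generating set $S$ such that, for some $\delta \ge 0$, all geodesic triangles in the Cayley graph of $G$ with respect to $S$ are $\delta$-thin. Let $H_1$ be a retract of $G$, i.e. a subgroup for which there is an epimorphism $f : G \to H_1$ with $f|_{H_1} = \mathrm{id}$, and let $H_2$ be an arbitrary subgroup of $G$. Suppose that $H_2$ is elementwise conjugate into $H_1$, i.e. every element of $H_2$ is conjugate in $G$ to an element of $H_1$. Then $H_2$ is conjugate into $H_1$: there is an element $c \in G$ such that $c^{-1} H_2 c \le H_1$. -/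

import Mathlib

namespace HypGroup

/-- The word metric on the group `G` with respect to a set `S`: the path distance between vertices
of the Cayley graph of `G` with respect to `S` (edges join `x` to `x * s` and `x * s⁻¹`). It is only
used when `S` generates `G`, so that the Cayley graph is connected. -/
noncomputable def wordDist {G : Type*} [Group G] (S : Set G) (x y : G) : ℝ :=
  ((SimpleGraph.mulCayley S).dist x y : ℝ)

/-- The Gromov inner product `(B, C)_A` for the word metric. -/
noncomputable def gromovProd {G : Type*} [Group G] (S : Set G) (A B C : G) : ℝ :=
  (wordDist S A B + wordDist S A C - wordDist S B C) / 2

/-- The vertex `P` lies on some geodesic from `A` to `B` in the Cayley graph. -/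
def OnGeodesic {G : Type*} [Group G] (S : Set G) (A B P : G) : Prop :=
  wordDist S A P + wordDist S P B = wordDist S A B

/-- Geodesic triangles in the Cayley graph of `G` with respect to `S` are `δ`-thin: if `P` is on a
side `[A, B]`, `Q` is on a side `[A, C]` and `|AP| = |AQ| ≤ (B, C)_A`, then `|PQ| ≤ δ`. Here the
triangle corners and the points `P`, `Q` are vertices of the Cayley graph. Any two vertices `P` and
`Q` on geodesics from `A` to `B` and from `A` to `C` lie on two sides of one geodesic triangle
with corners `A`, `B`, `C`, so quantifying over `P` and `Q` is quantifying over all geodesic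
triangles with these corners. Passing to corners and points in the interior of edges only changes
the constant `δ`. -/
def ThinTriangles {G : Type*} [Group G] (S : Set G) (δ : ℝ) : Prop :=
  ∀ A B C P Q : G, OnGeodesic S A B P → OnGeodesic S A C Q →
    wordDist S A P = wordDist S A Q → wordDist S A P ≤ gromovProd S A B C →
    wordDist S P Q ≤ δ

/-- `G` is a hyperbolic group: for some finite generating set `S` there is a `δ ≥ 0` such that the
geodesic triangles of the Cayley graph of `G` with respect to `S` are `δ`-thin. -/
def IsHyperbolicGroup (G : Type*) [Group G] : Prop :=
  ∃ S : Set G, S.Finite ∧ Subgroup.closure S = ⊤ ∧ ∃ δ : ℝ, 0 ≤ δ ∧ ThinTriangles S δ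

/-- `G` is torsion-free: no nontrivial element has finite order. (Mathlib's `IsMulTorsionFree` is
the stronger property that roots in `G` are unique.) -/
def IsTorsionFreeGroup (G : Type*) [Group G] : Prop :=
  ∀ g : G, IsOfFinOrder g → g = 1

/-- `H` is a retract of `G`: there is an epimorphism `f : G → H` that restricts to the identity
on `H`. -/
def IsRetract {G : Type*} [Group G] (H : Subgroup G) : Prop :=
  ∃ f : G →* H, Function.Surjective f ∧ ∀ h : H, f (h : G) = h

/-- `A` is conjugate into `B`: `c⁻¹ A c ≤ B` for some `c` in the ambient group. -/
def IsConjInto {G : Type*} [Group G] (A B : Subgroup G) : Prop :=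
  ∃ c : G, ∀ a ∈ A, c⁻¹ * a * c ∈ B

/-- `A` is elementwise conjugate into `B`: every element of `A` is conjugate, in the ambient group,
to an element of `B`. -/
def IsElementwiseConjInto {G : Type*} [Group G] (A B : Subgroup G) : Prop :=
  ∀ a ∈ A, ∃ b ∈ B, IsConj a b

end HypGroup

/-!
Composing the retraction `f : G → H₁` with the inclusions gives a homomorphism `φ : H₂ → G` that
maps every `h` to a conjugate of `h`: if `h` is conjugate to `b ∈ H₁`, then `f h` is conjugate to
`f b = b`. It therefore suffices that in a torsion-free hyperbolic group a homomorphism on a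
subgroup that maps every element to a conjugate is the restriction of an inner automorphism
(`exists_conj_of_forall_isConj`); the subgroup need not be finitely generated.

After composing `φ` with an inner automorphism, `φ a = a` for some `a ≠ 1`. For every `h` and `m`
the elements `h * a ^ m` and `φ h * a ^ m` are conjugate. If `h` does not commute with `a` and `m`
is large, their quasi-axes consist of long pieces of translates of the axis of `a`, and a conjugator
maps one quasi-axis to the other, so a long piece fellow travels a long piece. The pigeonhole
principle shows that the conjugator is `(h * a ^ m) ^ k * x` with `x` in the centralizer of `a`;
then `x` conjugates `h` to `φ h` (`exists_zpow_mul_of_semiconj`). So `φ` may be assumed to fix also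
an element `b` that does not commute with `a`, unless all of `H₂` commutes with `a`, where `φ` is
the identity by uniqueness of roots. For arbitrary `h`, the same result for `b` and `h * a ^ m`
yields a conjugator in the centralizer of `b`, which by the result for `a` has the form
`(h * a ^ m) ^ k * x`. If `k ≠ 0`, then the axis of `b` would follow a long piece of the axis of
`a` (`exists_not_commute_zpow_mul`); hence `k = 0`, the conjugator commutes with both `a` and `b`,
and so it is `1` and `φ h = h`.

The facts about hyperbolic groups that this uses are derived from the four-point condition: powers
of a nontrivial element form a quasi-geodesic (`exists_isLox`), and an element that conjugates a
nontrivial power of `a` to a power of `a` commutes with `a`, as the commensurator of `⟨a⟩` is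
virtually cyclic and torsion-free, hence abelian (`commute_of_conj_zpow`).
-/

namespace HypGroup

/-! ### Hyperbolic left-invariant metrics on a group -/

/-- `d` is a left-invariant, proper pseudometric on `G` with approximate midpoints that satisfies the
four-point condition of Gromov with constant `E`: among the three sums of distances of opposite
pairs of a quadruple, no sum exceeds both others by more than `E`. -/
structure IsHypMetric {G : Type*} [Group G] (d : G → G → ℝ) (E : ℝ) : Prop where
  self : ∀ x, d x x = 0
  symm : ∀ x y, d x y = d y x
  triangle : ∀ x y z, d x z ≤ d x y + d y z
  mul_left : ∀ g x y, d (g * x) (g * y) = d x y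
  four : ∀ x y z w, d x y + d z w ≤ d x z + d y w + E ∨ d x y + d z w ≤ d x w + d y z + E
  finite_ball : ∀ R, {g : G | d 1 g ≤ R}.Finite
  midpoint : ∀ x y, ∃ p, d x p + d p y = d x y ∧ d x y - 1 ≤ 2 * d x p ∧ 2 * d x p ≤ d x y

/-- `p` lies on a geodesic from `A` to `B` up to the error `K`: the Gromov product
`(A, B)_p` is at most `K / 2`. -/
def Between {G : Type*} (d : G → G → ℝ) (K : ℝ) (A p B : G) : Prop :=
  d A p + d p B ≤ d A B + K

namespace IsHypMetric

variable {G : Type*} [Group G] {d : G → G → ℝ} {E : ℝ}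

lemma nonneg (hd : IsHypMetric d E) (x y : G) : 0 ≤ d x y := by
  have h1 := hd.triangle x y x
  rw [hd.self, hd.symm y x] at h1
  linarith

lemma const_nonneg (hd : IsHypMetric d E) : 0 ≤ E := by
  have := hd.four 1 1 1 1
  simp only [hd.self] at this
  rcases this with h | h <;> linarith

lemma eq_norm (hd : IsHypMetric d E) (x y : G) : d x y = d 1 (x⁻¹ * y) := by
  rw [← hd.mul_left x⁻¹ x y, inv_mul_cancel]

lemma norm_inv (hd : IsHypMetric d E) (g : G) : d 1 g⁻¹ = d 1 g := by
  rw [hd.symm, hd.eq_norm]; simp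

lemma norm_mul_le (hd : IsHypMetric d E) (g h : G) : d 1 (g * h) ≤ d 1 g + d 1 h := by
  have := hd.triangle 1 g (g * h)
  rwa [hd.eq_norm g, inv_mul_cancel_left] at this

lemma norm_le_mul_left (hd : IsHypMetric d E) (g h : G) : d 1 h ≤ d 1 (g * h) + d 1 g := by
  have := hd.norm_mul_le g⁻¹ (g * h)
  rw [hd.norm_inv, inv_mul_cancel_left] at this
  linarith

lemma norm_le_mul_right (hd : IsHypMetric d E) (g h : G) : d 1 g ≤ d 1 (g * h) + d 1 h := by
  have := hd.norm_mul_le (g * h) h⁻¹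
  rw [hd.norm_inv, mul_inv_cancel_right] at this
  linarith

lemma norm_pow_le (hd : IsHypMetric d E) (g : G) (n : ℕ) : d 1 (g ^ n) ≤ n * d 1 g := by
  induction n with
  | zero => simp [hd.self]
  | succ n ih =>
    have := hd.norm_mul_le (g ^ n) g
    rw [pow_succ]
    push_cast
    linarith

lemma between_mul_left (hd : IsHypMetric d E) {K : ℝ} {A p B : G} (g : G) :
    Between d K (g * A) (g * p) (g * B) ↔ Between d K A p B := by
  simp [Between, hd.mul_left]

/-- Two points of the same quasi-line that are at about the same distance from one end are close. -/
lemma dist_le_of_between (hd : IsHypMetric d E) {K K' : ℝ} {A B p q : G}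
    (hp : Between d K A p B) (hq : Between d K' A q B) :
    d p q ≤ |d A p - d A q| + |K| + |K'| + E := by
  unfold Between at *
  have h1 := le_abs_self (d A p - d A q)
  have h2 := neg_abs_le (d A p - d A q)
  have := le_abs_self K
  have := le_abs_self K'
  have := abs_nonneg K
  have := abs_nonneg K'
  have := hd.symm p A
  have := hd.symm q A
  rcases hd.four p q A B with h | h <;> linarith

/-- Stability of quasi-lines: moving the ends of a quasi-line by at most `C` does not affect the
points far from the ends. -/
lemma between_of_close_ends (hd : IsHypMetric d E) {K C : ℝ} {A A' B B' p : G}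
    (h : Between d K A' p B') (hA : d A A' ≤ C) (hB : d B B' ≤ C)
    (hpA : C + K + 2 * E < d A p) (hpB : C + K + 2 * E < d p B) :
    Between d (K + 2 * E) A p B := by
  unfold Between at *
  have hE := hd.const_nonneg
  have h1 : d A p + d p B' ≤ d A B' + (K + E) := by
    have := hd.nonneg A' p
    have e1 := hd.symm A' A
    have e2 := hd.symm B' p
    have e3 := hd.symm B' A
    have e4 := hd.symm p A
    rcases hd.four A' B' A p with h | h <;> linarith
  have := hd.nonneg p B'
  have e1 := hd.symm B' B
  have e2 := hd.symm p A
  have e3 := hd.symm B p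
  rcases hd.four A B' p B with h | h <;> linarith [hd.symm B' p]

/-- A point of a quasi-line through the points `x 0, …, x n` lies between two consecutive ones. -/
lemma exists_between_succ (hd : IsHypMetric d E) {K K' : ℝ} (hK : 0 ≤ K) (hK' : 0 ≤ K')
    (x : ℕ → G) {n : ℕ} (hn : 0 < n) (hx : ∀ j ≤ n, Between d K (x 0) (x j) (x n)) {p : G}
    (hp : Between d K' (x 0) p (x n)) :
    ∃ j < n, Between d (4 * K + 4 * K' + 2 * E) (x j) p (x (j + 1)) := by
  obtain ⟨j, hjn, hj1, hj2⟩ : ∃ j < n, d (x 0) (x j) ≤ d (x 0) p ∧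
      d (x 0) p ≤ d (x 0) (x (j + 1)) + K' := by
    by_contra! hcon
    have key : ∀ j, j < n → d (x 0) (x j) ≤ d (x 0) p := by
      intro j
      induction j with
      | zero => intro _; rw [hd.self]; exact hd.nonneg _ _
      | succ j ih =>
        intro hj
        have := hcon j (by omega) (ih (by omega))
        linarith
    have h1 := hcon (n - 1) (by omega) (key _ (by omega))
    rw [Nat.sub_add_cancel hn] at h1
    unfold Between at hp
    linarith [hd.nonneg p (x n)]
  refine ⟨j, hjn, ?_⟩
  have hu := hd.dist_le_of_between hp (hx j hjn.le)
  have hv := hd.dist_le_of_between hp (hx (j + 1) hjn)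
  rw [abs_of_nonneg hK, abs_of_nonneg hK'] at hu hv
  rw [abs_of_nonneg (by linarith)] at hu
  have habs : |d (x 0) p - d (x 0) (x (j + 1))| ≤ d (x 0) (x (j + 1)) - d (x 0) p + 2 * K' :=
    abs_le.2 ⟨by linarith, by linarith⟩
  unfold Between
  have := hd.triangle (x 0) (x j) (x (j + 1))
  rw [hd.symm p] at hu
  linarith

end IsHypMetric

/-! ### The word metric of a hyperbolic group -/

section WordMetric

variable {G : Type*} [Group G] {S : Set G}

lemma mulCayley_connected (hS : Subgroup.closure S = ⊤) :
    (SimpleGraph.mulCayley S).Connected := by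
  have key : ∀ g : G, ∀ x : G, (SimpleGraph.mulCayley S).Reachable x (x * g) := by
    intro g
    have hg : g ∈ Subgroup.closure S := hS ▸ Subgroup.mem_top g
    induction hg using Subgroup.closure_induction with
    | mem s hs =>
      intro x
      by_cases h : x = x * s
      · rw [← h]
      · exact SimpleGraph.Adj.reachable
          ((SimpleGraph.mulCayley_adj S _ _).2 ⟨h, Or.inl (by simpa using hs)⟩)
    | one => intro x; simp
    | mul g h _ _ ihg ihh =>
      intro x
      rw [← mul_assoc]
      exact (ihg x).trans (ihh _)
    | inv g _ ih =>
      intro x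
      have := ih (x * g⁻¹)
      rw [inv_mul_cancel_right] at this
      exact this.symm
  refine (SimpleGraph.connected_iff _).2 ⟨fun x y => ?_, ⟨1⟩⟩
  simpa using key (x⁻¹ * y) x

lemma dist_mul_left (hS : Subgroup.closure S = ⊤) (g x y : G) :
    (SimpleGraph.mulCayley S).dist (g * x) (g * y) = (SimpleGraph.mulCayley S).dist x y := by
  have hle : ∀ g x y : G, (SimpleGraph.mulCayley S).dist (g * x) (g * y) ≤
      (SimpleGraph.mulCayley S).dist x y := by
    intro g x y
    obtain ⟨w, hw⟩ := (mulCayley_connected hS).exists_walk_length_eq_dist x y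
    let φ : SimpleGraph.mulCayley S →g SimpleGraph.mulCayley S :=
      ⟨fun z => g * z, fun h => SimpleGraph.mulCayley_adj_mul_iff_right.2 h⟩
    rw [← hw, ← SimpleGraph.Walk.length_map φ w]
    exact SimpleGraph.dist_le _
  refine le_antisymm (hle g x y) ?_
  simpa using hle g⁻¹ (g * x) (g * y)

lemma exists_onGeodesic (hS : Subgroup.closure S = ⊤) (x y : G) {t : ℕ}
    (ht : t ≤ (SimpleGraph.mulCayley S).dist x y) :
    ∃ p, wordDist S x p = t ∧ OnGeodesic S x y p := by
  have hc := mulCayley_connected hS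
  obtain ⟨w, hw⟩ := hc.exists_walk_length_eq_dist x y
  have h1 : (SimpleGraph.mulCayley S).dist x (w.getVert t) ≤ t := by
    refine (SimpleGraph.dist_le (w.take t)).trans ?_
    rw [SimpleGraph.Walk.take_length]
    exact min_le_left _ _
  have h2 : (SimpleGraph.mulCayley S).dist (w.getVert t) y ≤ w.length - t := by
    refine (SimpleGraph.dist_le (w.drop t)).trans ?_
    rw [SimpleGraph.Walk.drop_length]
  have h3 := hc.dist_triangle (u := x) (v := w.getVert t) (w := y)
  refine ⟨w.getVert t, ?_, ?_⟩
  · unfold wordDist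
    exact_mod_cast (by omega : (SimpleGraph.mulCayley S).dist x (w.getVert t) = t)
  · unfold OnGeodesic wordDist
    exact_mod_cast (by omega : (SimpleGraph.mulCayley S).dist x (w.getVert t) +
      (SimpleGraph.mulCayley S).dist (w.getVert t) y = (SimpleGraph.mulCayley S).dist x y)

lemma finite_wordBall (hfin : S.Finite) (hS : Subgroup.closure S = ⊤) (n : ℕ) :
    {g : G | (SimpleGraph.mulCayley S).dist 1 g ≤ n}.Finite := by
  have hc := mulCayley_connected hS
  induction n with
  | zero =>
    refine (Set.finite_singleton (1 : G)).subset fun g hg => ?_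
    simp only [Set.mem_ofPred_eq, Nat.le_zero, hc.dist_eq_zero_iff] at hg
    exact hg.symm
  | succ n ih =>
    have hfin2 : (S ∪ S⁻¹ ∪ {1}).Finite := (hfin.union hfin.inv).union (Set.finite_singleton _)
    refine (ih.mul hfin2).subset fun g hg => ?_
    rcases Nat.lt_or_ge n ((SimpleGraph.mulCayley S).dist 1 g) with h | h
    · obtain ⟨w, hw⟩ := hc.exists_walk_length_eq_dist 1 g
      have hadj : (SimpleGraph.mulCayley S).Adj (w.getVert n) (w.getVert (n + 1)) :=
        w.adj_getVert_succ (by omega)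
      have hg' : (SimpleGraph.mulCayley S).dist 1 g ≤ n + 1 := hg
      rw [w.getVert_of_length_le (by omega : w.length ≤ n + 1)] at hadj
      refine ⟨w.getVert n, ?_, (w.getVert n)⁻¹ * g, ?_, by simp⟩
      · refine (SimpleGraph.dist_le (w.take n)).trans ?_
        rw [SimpleGraph.Walk.take_length]
        exact min_le_left _ _
      · rcases ((SimpleGraph.mulCayley_adj S _ _).1 hadj).2 with h | h
        · exact Or.inl (Or.inl h)
        · exact Or.inl (Or.inr (by simpa using h))
    · exact ⟨g, h, 1, Or.inr rfl, by simp⟩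

/-- The word metric of a hyperbolic group satisfies the four-point condition. For corners
`x, y, z` seen from `w`, the points at distance `⌊min ((x, y)_w, (y, z)_w)⌋` from `w` on geodesics
from `w` to `x`, `y` and `z` are `δ`-close in succession; the floor is responsible for the summand `1`. -/
lemma isHypMetric_wordDist (hfin : S.Finite) (hS : Subgroup.closure S = ⊤) {δ : ℝ}
    (hδ : ThinTriangles S δ) : IsHypMetric (wordDist S) (2 * (δ + 1)) where
  self x := by simp [wordDist]
  symm x y := by simp [wordDist, SimpleGraph.dist_comm]
  triangle x y z := by
    unfold wordDist
    exact_mod_cast (mulCayley_connected hS).dist_triangle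
  mul_left g x y := by
    unfold wordDist
    exact_mod_cast dist_mul_left hS g x y
  four x z y w := by
    have hc := mulCayley_connected hS
    have symm : ∀ x y : G, wordDist S x y = wordDist S y x := fun x y => by
      simp [wordDist, SimpleGraph.dist_comm]
    have tri : ∀ x y z : G, wordDist S x z ≤ wordDist S x y + wordDist S y z := fun x y z => by
      unfold wordDist
      exact_mod_cast hc.dist_triangle
    set μ := min (gromovProd S w x y) (gromovProd S w y z) with hμ
    have hμ1 : μ ≤ gromovProd S w x y := min_le_left _ _
    have hμ2 : μ ≤ gromovProd S w y z := min_le_right _ _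
    have hμ0 : 0 ≤ μ := by
      refine le_min ?_ ?_ <;> unfold gromovProd
      · linarith [tri x w y, symm x w]
      · linarith [tri y w z, symm y w]
    set t := ⌊μ⌋₊ with ht
    have ht1 : (t : ℝ) ≤ μ := Nat.floor_le hμ0
    have ht2 : μ < t + 1 := Nat.lt_floor_add_one μ
    have bound : ∀ u v : G, (t : ℝ) ≤ gromovProd S w u v → (t : ℝ) ≤ wordDist S w u := by
      intro u v h
      unfold gromovProd at h
      linarith [tri w u v]
    have bound' : ∀ u v : G, (t : ℝ) ≤ gromovProd S w u v → (t : ℝ) ≤ wordDist S w v := by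
      intro u v h
      unfold gromovProd at h
      linarith [tri w v u, symm u v]
    have geo : ∀ u : G, (t : ℝ) ≤ wordDist S w u →
        ∃ p, wordDist S w p = t ∧ OnGeodesic S w u p := by
      intro u h
      exact exists_onGeodesic hS w u (by unfold wordDist at h; exact_mod_cast h)
    obtain ⟨X, hX1, hX2⟩ := geo x (bound x y (by linarith))
    obtain ⟨Y, hY1, hY2⟩ := geo y (bound' x y (by linarith))
    obtain ⟨Z, hZ1, hZ2⟩ := geo z (bound' y z (by linarith))
    have hXY := hδ w x y X Y hX2 hY2 (by rw [hX1, hY1]) (by linarith)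
    have hYZ := hδ w y z Y Z hY2 hZ2 (by rw [hY1, hZ1]) (by linarith)
    unfold OnGeodesic at hX2 hZ2
    have e1 := tri x X z
    have e2 := tri X Y z
    have e3 := tri Y Z z
    have e4 := symm x X
    have e5 := symm x w
    have e6 := symm y w
    have e7 := symm z w
    have e8 := symm z y
    rcases min_choice (gromovProd S w x y) (gromovProd S w y z) with h | h
    · left
      rw [← hμ] at h
      unfold gromovProd at h
      linarith
    · right
      rw [← hμ] at h
      unfold gromovProd at h
      linarith
  finite_ball R := by
    refine (finite_wordBall hfin hS ⌊R⌋₊).subset fun g hg => ?_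
    have : ((SimpleGraph.mulCayley S).dist 1 g : ℝ) ≤ R := hg
    exact Nat.le_floor this
  midpoint x y := by
    obtain ⟨p, hp1, hp2⟩ := exists_onGeodesic hS x y
      (t := (SimpleGraph.mulCayley S).dist x y / 2) (by omega)
    refine ⟨p, hp2, ?_, ?_⟩ <;> rw [hp1] <;> unfold wordDist
    · have : (SimpleGraph.mulCayley S).dist x y ≤
        2 * ((SimpleGraph.mulCayley S).dist x y / 2) + 1 := by omega
      have : ((SimpleGraph.mulCayley S).dist x y : ℝ) ≤
        2 * ((SimpleGraph.mulCayley S).dist x y / 2 : ℕ) + 1 := by exact_mod_cast this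
      linarith
    · have : 2 * ((SimpleGraph.mulCayley S).dist x y / 2) ≤
        (SimpleGraph.mulCayley S).dist x y := by omega
      exact_mod_cast this

end WordMetric

/-! ### Powers of a nontrivial element form a quasi-geodesic -/

/-- The powers of `a` lie on a quasi-line with error `K`: the distances between successive powers
of `a` are additive up to `K`. -/
def IsLox {G : Type*} [Group G] (d : G → G → ℝ) (K : ℝ) (a : G) : Prop :=
  ∀ i j : ℕ, d 1 (a ^ i) + d 1 (a ^ j) ≤ d 1 (a ^ (i + j)) + K

section TorsionFree

variable {G : Type*} [Group G]

lemma IsTorsionFreeGroup.pow_injective (htf : IsTorsionFreeGroup G) {a : G} (ha : a ≠ 1) :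
    Function.Injective fun n : ℕ => a ^ n :=
  injective_pow_iff_not_isOfFinOrder.2 fun h => ha (htf a h)

lemma IsTorsionFreeGroup.zpow_injective (htf : IsTorsionFreeGroup G) {a : G} (ha : a ≠ 1) :
    Function.Injective fun n : ℤ => a ^ n :=
  injective_zpow_iff_not_isOfFinOrder.2 fun h => ha (htf a h)

lemma IsTorsionFreeGroup.zpow_ne_one (htf : IsTorsionFreeGroup G) {a : G} (ha : a ≠ 1) {n : ℤ}
    (hn : n ≠ 0) : a ^ n ≠ 1 := fun h => hn (htf.zpow_injective ha (by simpa using h))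

end TorsionFree

namespace IsLox

variable {G : Type*} [Group G] {d : G → G → ℝ} {E K : ℝ} {a : G}

lemma nonneg (ha : IsLox d K a) (hd : IsHypMetric d E) : 0 ≤ K := by
  have := ha 0 0
  simp only [add_zero, pow_zero, hd.self] at this
  linarith

lemma mono (ha : IsLox d K a) {K' : ℝ} (h : K ≤ K') : IsLox d K' a := fun i j => by
  linarith [ha i j]

lemma inv (ha : IsLox d K a) (hd : IsHypMetric d E) : IsLox d K a⁻¹ := fun i j => by
  simpa [hd.norm_inv] using ha i j

lemma norm_pow_le (ha : IsLox d K a) (hd : IsHypMetric d E) {i n : ℕ} (h : i ≤ n) :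
    d 1 (a ^ i) ≤ d 1 (a ^ n) + K := by
  have := ha i (n - i)
  rw [Nat.add_sub_cancel' h] at this
  linarith [hd.nonneg 1 (a ^ (n - i))]

lemma le_norm_pow (ha : IsLox d K a) (hd : IsHypMetric d E) (n : ℕ) :
    n * (d 1 a - K) ≤ d 1 (a ^ n) := by
  induction n with
  | zero => simp [hd.self]
  | succ n ih =>
    have := ha n 1
    rw [pow_one] at this
    push_cast
    linarith

lemma between_pow (ha : IsLox d K a) (hd : IsHypMetric d E) {i n : ℕ} (h : i ≤ n) :
    Between d K 1 (a ^ i) (a ^ n) := by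
  have := ha i (n - i)
  unfold Between
  rw [hd.eq_norm (a ^ i), show (a ^ i)⁻¹ * a ^ n = a ^ (n - i) by
    rw [inv_mul_eq_iff_eq_mul, ← pow_add, Nat.add_sub_cancel' h]]
  rwa [Nat.add_sub_cancel' h] at this

/-- The quasi-line through the powers of `a` consists of points close to powers of `a`. -/
lemma exists_near_pow (ha : IsLox d K a) (hd : IsHypMetric d E) {K' : ℝ} (hK' : 0 ≤ K') :
    ∃ R, ∀ (n : ℕ) (p : G), Between d K' 1 p (a ^ n) → ∃ j ≤ n, d p (a ^ j) ≤ R := by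
  have hK := ha.nonneg hd
  have hE := hd.const_nonneg
  refine ⟨d 1 a + (4 * K + 4 * K' + 2 * E), fun n p hp => ?_⟩
  rcases Nat.eq_zero_or_pos n with rfl | hn
  · refine ⟨0, le_rfl, ?_⟩
    simp only [Between, pow_zero, hd.self] at hp ⊢
    linarith [hd.nonneg 1 p, hd.nonneg 1 a]
  · obtain ⟨j, hj, hB⟩ := hd.exists_between_succ hK hK' (fun j => a ^ j) hn
      (fun j hj => by simpa using ha.between_pow hd hj) (p := p) (by simpa using hp)
    refine ⟨j, hj.le, ?_⟩
    simp only [Between] at hB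
    rw [hd.eq_norm (a ^ j) (a ^ (j + 1)), pow_succ, inv_mul_cancel_left, hd.symm _ p] at hB
    linarith [hd.nonneg p (a ^ j * a)]

lemma exists_near_zpow (ha : IsLox d K a) (hd : IsHypMetric d E) {K' : ℝ} (hK' : 0 ≤ K') :
    ∃ R, ∀ (n : ℤ) (p : G), Between d K' 1 p (a ^ n) → ∃ j : ℤ, d p (a ^ j) ≤ R := by
  obtain ⟨R₁, h₁⟩ := ha.exists_near_pow hd hK'
  obtain ⟨R₂, h₂⟩ := (ha.inv hd).exists_near_pow hd hK'
  refine ⟨max R₁ R₂, fun n p hp => ?_⟩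
  obtain ⟨n, rfl | rfl⟩ := n.eq_nat_or_neg
  · obtain ⟨j, -, hj⟩ := h₁ n p (by simpa using hp)
    exact ⟨j, by simpa using Or.inl hj⟩
  · obtain ⟨j, -, hj⟩ := h₂ n p (by simpa using hp)
    exact ⟨-j, by simpa using Or.inr hj⟩

lemma of_conj (hd : IsHypMetric d E) (p : G) (ha : IsLox d K (p⁻¹ * a * p)) :
    IsLox d (K + 6 * d 1 p) a := by
  have hpow : ∀ n : ℕ, a ^ n = p * (p⁻¹ * a * p) ^ n * p⁻¹ := fun n => by
    have := conj_pow (i := n) (a := p⁻¹) (b := a)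
    rw [inv_inv] at this
    rw [this]; group
  have h1 : ∀ n : ℕ, d 1 (a ^ n) ≤ d 1 ((p⁻¹ * a * p) ^ n) + 2 * d 1 p := fun n => by
    have e1 := hd.norm_mul_le (p * (p⁻¹ * a * p) ^ n) p⁻¹
    have e2 := hd.norm_mul_le p ((p⁻¹ * a * p) ^ n)
    rw [← hpow, hd.norm_inv] at e1
    linarith
  have h2 : ∀ n : ℕ, d 1 ((p⁻¹ * a * p) ^ n) ≤ d 1 (a ^ n) + 2 * d 1 p := fun n => by
    have e1 := hd.norm_le_mul_right (p * (p⁻¹ * a * p) ^ n) p⁻¹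
    have e2 := hd.norm_le_mul_left p ((p⁻¹ * a * p) ^ n)
    rw [← hpow, hd.norm_inv] at e1
    linarith
  intro i j
  linarith [ha i j, h1 i, h1 j, h2 (i + j)]

lemma of_pow (hd : IsHypMetric d E) {m : ℕ} (hm : 0 < m) (ha : IsLox d K (a ^ m)) :
    ∃ K', IsLox d K' a := by
  have hr : ∀ n : ℕ, d 1 (a ^ (n % m)) ≤ m * d 1 a := fun n => by
    refine (hd.norm_pow_le a _).trans (mul_le_mul_of_nonneg_right ?_ (hd.nonneg _ _))
    exact_mod_cast (Nat.mod_lt n hm).le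
  have h1 : ∀ n : ℕ, d 1 (a ^ n) ≤ d 1 ((a ^ m) ^ (n / m)) + m * d 1 a := fun n => by
    have := hd.norm_mul_le ((a ^ m) ^ (n / m)) (a ^ (n % m))
    rw [← pow_mul, ← pow_add, Nat.div_add_mod] at this
    rw [← pow_mul]
    linarith [hr n]
  refine ⟨K + 4 * (m * d 1 a), fun i j => ?_⟩
  have h2 := hd.norm_le_mul_right ((a ^ m) ^ (i / m + j / m)) (a ^ (i % m) * a ^ (j % m))
  have h3 := hd.norm_mul_le (a ^ (i % m)) (a ^ (j % m))
  have h4 : (a ^ m) ^ (i / m + j / m) * (a ^ (i % m) * a ^ (j % m)) = a ^ (i + j) := by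
    rw [← pow_mul, ← pow_add, ← pow_add]
    congr 1
    have := Nat.div_add_mod i m
    have := Nat.div_add_mod j m
    rw [mul_add]
    omega
  rw [h4] at h2
  linarith [ha (i / m) (j / m), h1 i, h1 j, hr i, hr j]

end IsLox

namespace IsHypMetric

variable {G : Type*} [Group G] {d : G → G → ℝ} {E : ℝ}

/-- Local-to-global principle: if the broken line through the powers of `y` has long steps and is
almost straight at each vertex, then it is almost straight globally. -/
lemma isLox_of_sq (hd : IsHypMetric d E) {K : ℝ} {y : G} (h2 : 2 * d 1 y ≤ d 1 (y ^ 2) + K)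
    (hy : K + 2 * E + 1 ≤ d 1 y) : IsLox d (K + 2 * E) y := by
  have hE := hd.const_nonneg
  have pw : ∀ {i j : ℕ}, i ≤ j → d (y ^ i) (y ^ j) = d 1 (y ^ (j - i)) := fun {i j} h => by
    rw [hd.eq_norm, inv_mul_eq_iff_eq_mul.2]
    rw [← pow_add, Nat.add_sub_cancel' h]
  have step : ∀ n : ℕ, d 1 (y ^ n) + d 1 y ≤ d 1 (y ^ (n + 1)) + K + E := by
    intro n
    induction n with
    | zero =>
      have := hd.norm_mul_le y y
      rw [← pow_two] at this
      simp only [pow_zero, hd.self, zero_add, pow_one]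
      linarith
    | succ n ih =>
      have e1 := pw (show n ≤ n + 1 + 1 by omega)
      have e2 := pw (show n ≤ n + 1 by omega)
      have e3 := pw (show n + 1 ≤ n + 1 + 1 by omega)
      rw [show n + 1 + 1 - n = 2 by omega] at e1
      rw [show n + 1 - n = 1 by omega, pow_one] at e2
      rw [show n + 1 + 1 - (n + 1) = 1 by omega, pow_one] at e3
      have e4 := hd.symm (y ^ n) 1
      have e5 := hd.symm (y ^ (n + 1 + 1)) (y ^ (n + 1))
      have e6 := hd.symm (y ^ (n + 1 + 1)) 1
      rcases hd.four (y ^ n) (y ^ (n + 1 + 1)) (y ^ (n + 1)) 1 with h | h <;>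
        rw [hd.symm (y ^ (n + 1)) 1] at h <;> linarith
  intro j r
  cases r with
  | zero =>
    have := step 0
    simp only [pow_zero, hd.self, zero_add, pow_one] at this
    simp only [pow_zero, hd.self, add_zero]
    linarith
  | succ r =>
    have e1 := pw (show j ≤ j + (r + 1) by omega)
    have e2 := pw (show j + 1 ≤ j + (r + 1) by omega)
    have e3 := pw (show j ≤ j + 1 by omega)
    rw [show j + (r + 1) - j = r + 1 by omega] at e1
    rw [show j + (r + 1) - (j + 1) = r by omega] at e2
    rw [show j + 1 - j = 1 by omega, pow_one] at e3
    have e4 := hd.symm (y ^ (j + 1)) (y ^ j)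
    rcases hd.four 1 (y ^ (j + 1)) (y ^ j) (y ^ (j + (r + 1))) with h | h
    · linarith [step j, step r]
    · linarith [step j, step r]

lemma exists_lt_norm_pow (hd : IsHypMetric d E) (htf : IsTorsionFreeGroup G) {a : G}
    (ha : a ≠ 1) (C : ℝ) : ∃ N : ℕ, ∀ n ≥ N, C < d 1 (a ^ n) := by
  have hfin : {n : ℕ | d 1 (a ^ n) ≤ C}.Finite :=
    (hd.finite_ball C).preimage (htf.pow_injective ha).injOn
  obtain ⟨N, hN⟩ := hfin.bddAbove
  refine ⟨N + 1, fun n hn => ?_⟩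
  by_contra! h
  have := hN (show n ∈ {n : ℕ | d 1 (a ^ n) ≤ C} from h)
  omega

/-- The powers of a nontrivial element of a torsion-free hyperbolic group form a quasi-geodesic.
A small power `a ^ m` almost preserves a long geodesic from `1` to `a ^ n`. As the conjugates
`p⁻¹ * a ^ m * p` by its midpoint `p` are distinct, one of them is long; it moves `p` along the
geodesic, so `isLox_of_sq` applies to it. -/
theorem exists_isLox (hd : IsHypMetric d E) (htf : IsTorsionFreeGroup G) {a : G} (ha : a ≠ 1) :
    ∃ K, IsLox d K a := by
  classical
  have hE := hd.const_nonneg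
  set F := (hd.finite_ball (12 * E + 1)).toFinset with hF
  set M := F.card + 1 with hM
  set C := M * d 1 a with hC
  have hC0 : 0 ≤ C := mul_nonneg (Nat.cast_nonneg _) (hd.nonneg _ _)
  obtain ⟨N, hN⟩ := hd.exists_lt_norm_pow htf ha (8 * C + 20 * E + 2)
  have hL := hN N le_rfl
  obtain ⟨p, hp1, hp2, hp3⟩ := hd.midpoint 1 (a ^ N)
  have shift : ∀ m ≤ M, Between d (2 * E) 1 (a ^ m * p) (a ^ N) ∧ d 1 (a ^ m) ≤ C := by
    intro m hm
    have hmC : d 1 (a ^ m) ≤ C := (hd.norm_pow_le a m).trans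
      (mul_le_mul_of_nonneg_right (by exact_mod_cast hm) (hd.nonneg _ _))
    refine ⟨?_, hmC⟩
    have h0 : Between d 0 (a ^ m * 1) (a ^ m * p) (a ^ m * a ^ N) :=
      (hd.between_mul_left _).2 (by unfold Between; linarith)
    rw [mul_one] at h0
    have hend : d (a ^ N) (a ^ m * a ^ N) ≤ C := by
      rw [← pow_add, add_comm, pow_add, hd.eq_norm, inv_mul_cancel_left]
      exact hmC
    have e1 := hd.mul_left (a ^ m) 1 p
    have e2 := hd.mul_left (a ^ m) p (a ^ N)
    rw [mul_one] at e1
    have e3 := hd.triangle (a ^ m) 1 (a ^ m * p)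
    have e4 := hd.triangle (a ^ m * p) (a ^ N) (a ^ m * a ^ N)
    rw [hd.symm (a ^ m) 1] at e3
    have := hd.between_of_close_ends h0 hmC hend (by linarith) (by linarith)
    simpa using this
  have hpB : Between d 0 1 p (a ^ N) := by unfold Between; linarith
  have hdist : ∀ m ≤ M, d p (a ^ m * p) ≤ |d 1 (a ^ m * p) - d 1 p| + 3 * E := by
    intro m hm
    have := hd.dist_le_of_between hpB (shift m hm).1
    rw [abs_zero, abs_of_nonneg (by linarith : 0 ≤ 2 * E), abs_sub_comm] at this
    linarith
  obtain ⟨m, hm, hms⟩ : ∃ m ≤ M, 9 * E + 1 ≤ |d 1 (a ^ m * p) - d 1 p| := by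
    by_contra! hcon
    obtain ⟨i, -, j, -, hij, he⟩ := Finset.exists_ne_map_eq_of_card_lt_of_maps_to
      (s := Finset.range M) (t := F) (by simp [hM]) (f := fun m => p⁻¹ * (a ^ m * p)) (by
        intro m hm
        have hmM : m ≤ M := (Finset.mem_range.1 (Finset.mem_coe.1 hm)).le
        simp only [hF, Set.Finite.coe_toFinset]
        change d 1 _ ≤ _
        rw [← hd.eq_norm]
        linarith [hdist m hmM, hcon m hmM])
    refine hij (htf.pow_injective ha ?_)
    simpa using he
  have hm0 : 0 < m := by
    rcases Nat.eq_zero_or_pos m with rfl | h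
    · simp only [pow_zero, one_mul, sub_self, abs_zero] at hms
      linarith
    · exact h
  obtain ⟨hB, hmC⟩ := shift m hm
  have hds := hdist m hm
  set y := a ^ m with hy
  have e1 := hd.mul_left y 1 p
  rw [mul_one] at e1
  have e2 := hd.triangle 1 p (y * p)
  have e3 := hd.triangle 1 (y * p) p
  rw [hd.symm (y * p) p] at e3
  have hs1 : |d 1 (y * p) - d 1 p| ≤ d p (y * p) := abs_le.2 ⟨by linarith, by linarith⟩
  have e4 := hd.triangle 1 y (y * p)
  have e5 := hd.triangle y 1 (y * p)
  rw [hd.symm y 1] at e5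
  have hs2 : |d 1 (y * p) - d 1 p| ≤ C := abs_le.2 ⟨by linarith, by linarith⟩
  have e6 := hd.triangle 1 y p
  have hyp1 : d y p ≤ 2 * d 1 p - d 1 (y * p) + E := by
    have := hd.symm (y * p) p
    have := hd.symm (y * p) y
    rcases hd.four 1 (y * p) y p with h | h <;> linarith
  have hyp2 : 2 * d 1 p - d 1 (y * p) - E ≤ d y p := by
    have := hd.symm p y
    rcases hd.four 1 p y (y * p) with h | h <;> linarith
  set z := p⁻¹ * y * p with hz
  have hz1 : d 1 z = d p (y * p) := by rw [hd.eq_norm p, hz, mul_assoc]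
  have hz2 : d 1 (z ^ 2) = d (y⁻¹ * p) (y * p) := by
    rw [hd.eq_norm (y⁻¹ * p), hz, pow_two]
    congr 1
    group
  have hz3 : 2 * |d 1 (y * p) - d 1 p| ≤ d 1 (z ^ 2) + E := by
    have e7 : d 1 (y⁻¹ * p) = d y p := by rw [hd.eq_norm y]
    have e8 := hd.triangle 1 (y⁻¹ * p) (y * p)
    have e9 := hd.triangle 1 (y * p) (y⁻¹ * p)
    rw [hd.symm (y * p) (y⁻¹ * p)] at e9
    rw [hz2]
    rcases abs_cases (d 1 (y * p) - d 1 p) with ⟨h, -⟩ | ⟨h, -⟩ <;> rw [h] <;> linarith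
  have hlox : IsLox d (7 * E + 2 * E) z := hd.isLox_of_sq (by linarith) (by linarith)
  exact (IsLox.of_conj hd p hlox).of_pow hd hm0

end IsHypMetric

/-! ### Centralizers in torsion-free hyperbolic groups are abelian -/

/-- A torsion-free group that is virtually cyclic is abelian: its center has finite index, so by
the transfer homomorphism a fixed power of every commutator is trivial. -/
lemma commute_of_finiteIndex_zpowers {H : Type*} [Group H] (htf : IsTorsionFreeGroup H) (a : H)
    [(Subgroup.zpowers a).FiniteIndex] (g h : H) : Commute g h := by
  classical
  have hcomm : ∀ g : H, ∃ l : ℤ, l ≠ 0 ∧ Commute g (a ^ l) := by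
    intro g
    by_cases hg : g = 1
    · exact ⟨1, one_ne_zero, hg ▸ Commute.one_left _⟩
    · obtain ⟨n, hn, -, hmem⟩ := Subgroup.exists_pow_mem_of_index_ne_zero
        (H := Subgroup.zpowers a) Subgroup.FiniteIndex.index_ne_zero g
      obtain ⟨l, hl⟩ := Subgroup.mem_zpowers_iff.1 hmem
      refine ⟨l, ?_, hl ▸ (Commute.refl g).pow_right n⟩
      rintro rfl
      rw [zpow_zero] at hl
      exact hg (htf g (isOfFinOrder_iff_pow_eq_one.2 ⟨n, hn, hl.symm⟩))
  choose l hl0 hl using hcomm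
  have : Fintype (H ⧸ Subgroup.zpowers a) := Fintype.ofFinite _
  set L : ℤ := ∏ q : H ⧸ Subgroup.zpowers a, l q.out with hL
  have hL0 : L ≠ 0 := Finset.prod_ne_zero_iff.2 fun q _ => hl0 _
  have hrep : ∀ g : H, ∃ k : ℤ, g = (QuotientGroup.mk g : H ⧸ Subgroup.zpowers a).out * a ^ k := by
    intro g
    obtain ⟨⟨_, k, rfl⟩, hk⟩ := QuotientGroup.mk_out_eq_mul (Subgroup.zpowers a) g
    refine ⟨-k, ?_⟩
    simp only at hk
    rw [hk]
    simp
  have hcenter : a ^ L ∈ Subgroup.center H := by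
    rw [Subgroup.mem_center_iff]
    intro g
    obtain ⟨k, hk⟩ := hrep g
    set q : H ⧸ Subgroup.zpowers a := QuotientGroup.mk g
    have h1 : Commute q.out (a ^ L) := by
      obtain ⟨c, hc⟩ := Finset.dvd_prod_of_mem (fun q : H ⧸ Subgroup.zpowers a => l q.out)
        (Finset.mem_univ q)
      rw [hL, hc, zpow_mul]
      exact (hl _).zpow_right c
    have h2 : Commute (a ^ k) (a ^ L) := Commute.zpow_zpow_self a k L
    rw [hk]
    exact h1.mul_left h2
  have : (Subgroup.center H).FiniteIndex := by
    have hsurj : Function.Surjective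
        fun x : (H ⧸ Subgroup.zpowers a) × Set.Ico (0 : ℤ) |L| =>
          (QuotientGroup.mk (x.1.out * a ^ (x.2 : ℤ)) : H ⧸ Subgroup.center H) := by
      intro y
      induction y using QuotientGroup.induction_on with
      | H g =>
        obtain ⟨k, hk⟩ := hrep g
        refine ⟨(QuotientGroup.mk g, ⟨k % L, Int.emod_nonneg k hL0, Int.emod_lt_abs k hL0⟩), ?_⟩
        rw [QuotientGroup.eq]
        have : ((QuotientGroup.mk g : H ⧸ Subgroup.zpowers a).out * a ^ (k % L))⁻¹ * g =
            (a ^ L) ^ (k / L) := by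
          nth_rw 2 [hk]
          rw [mul_inv_rev, mul_assoc, inv_mul_cancel_left, ← zpow_neg, ← zpow_add, ← zpow_mul]
          congr 1
          have := Int.emod_add_mul_ediv k L
          linarith
        simp only
        rw [this]
        exact Subgroup.zpow_mem _ hcenter _
    have := Finite.of_surjective _ hsurj
    exact Subgroup.finiteIndex_of_finite_quotient
  have hpow : (g * h * g⁻¹ * h⁻¹) ^ (Subgroup.center H).index = 1 := by
    have : MonoidHom.transferCenterPow H (g * h * g⁻¹ * h⁻¹) = 1 := by
      have hc : MonoidHom.transferCenterPow H g * MonoidHom.transferCenterPow H h =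
          MonoidHom.transferCenterPow H h * MonoidHom.transferCenterPow H g :=
        Subtype.ext (Subgroup.mem_center_iff.1 (MonoidHom.transferCenterPow H h).2 _)
      simp only [map_mul, map_inv]
      rw [hc]
      group
    rw [← MonoidHom.transferCenterPow_apply, this]
    rfl
  have h1 := htf _ (isOfFinOrder_iff_pow_eq_one.2
    ⟨_, Nat.pos_of_ne_zero Subgroup.FiniteIndex.index_ne_zero, hpow⟩)
  rw [mul_inv_eq_one, mul_inv_eq_iff_eq_mul] at h1
  exact h1

namespace IsHypMetric

variable {G : Type*} [Group G] {d : G → G → ℝ} {E : ℝ}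

lemma between_of_mul (hd : IsHypMetric d E) {K : ℝ} {h q c : G} (hB : Between d K 1 q (h * c)) :
    Between d (K + 2 * d 1 h) 1 (h⁻¹ * q) c := by
  unfold Between at *
  have e1 := hd.mul_left h 1 (h⁻¹ * q)
  have e2 := hd.mul_left h (h⁻¹ * q) c
  rw [mul_inv_cancel_left] at e1 e2
  rw [mul_one] at e1
  have := hd.triangle h 1 q
  rw [hd.symm h 1] at this
  linarith [hd.norm_mul_le h c]

/-- An element that conjugates a nontrivial power of `a` to a power of `a` maps the quasi-line of
`a` to a quasi-line with the same ends, so it lies within a uniform distance of the powers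
of `a`. -/
lemma exists_near_of_conj_zpow (hd : IsHypMetric d E) (htf : IsTorsionFreeGroup G) {a : G}
    (ha : a ≠ 1) : ∃ R, ∀ (g : G) (p q : ℤ), p ≠ 0 → g * a ^ p * g⁻¹ = a ^ q →
      ∃ j : ℤ, d g (a ^ j) ≤ R := by
  obtain ⟨K, hK⟩ := hd.exists_isLox htf ha
  have hE := hd.const_nonneg
  have hK0 := hK.nonneg hd
  obtain ⟨R, hR⟩ := hK.exists_near_zpow hd (K' := K + 2 * E) (by linarith)
  have key : ∀ (g : G) (p : ℕ) (q : ℤ), p ≠ 0 → g * a ^ p * g⁻¹ = a ^ q →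
      ∃ j : ℤ, d g (a ^ j) ≤ R := by
    intro g p q hp h
    have hb : a ^ q ≠ 1 := by
      rw [← h]
      intro h1
      rw [mul_inv_eq_one, mul_eq_left] at h1
      exact htf.zpow_ne_one ha (n := p) (by exact_mod_cast hp) (by simpa using h1)
    obtain ⟨N, hN⟩ := hd.exists_lt_norm_pow htf hb (2 * d 1 g + K + 2 * E)
    have hN := hN N le_rfl
    set b := a ^ q with hbdef
    set c := a ^ p with hc
    have hgc : g * c ^ N = b ^ N * g := by
      have := conj_pow (i := N) (a := g) (b := c)
      rw [h] at this
      rw [this]; group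
    have hgc' : g * (c ^ N)⁻¹ = (b ^ N)⁻¹ * g := by
      rw [mul_inv_eq_iff_eq_mul, mul_assoc, hgc, inv_mul_cancel_left]
    have h0 : Between d K (c ^ N)⁻¹ 1 (c ^ N) := by
      unfold Between
      have e1 := hK (p * N) (p * N)
      have e2 : (c ^ N)⁻¹⁻¹ * c ^ N = a ^ (p * N + p * N) := by
        rw [inv_inv, hc, ← pow_mul, ← pow_add]
      rw [hd.eq_norm (c ^ N)⁻¹ (c ^ N), e2, hd.symm _ 1, hd.norm_inv, hc, ← pow_mul]
      exact e1
    have h1 := (hd.between_mul_left g).2 h0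
    rw [hgc, hgc', mul_one] at h1
    have h2 : Between d (K + 2 * E) (b ^ N)⁻¹ g (b ^ N) := by
      have e1 := hd.triangle 1 g (b ^ N)
      have e2 := hd.triangle (b ^ N)⁻¹ g 1
      rw [hd.symm (b ^ N)⁻¹ 1, hd.norm_inv, hd.symm g 1] at e2
      refine hd.between_of_close_ends (C := d 1 g) h1 ?_ ?_ (by linarith) (by linarith) <;>
        rw [hd.eq_norm, inv_mul_cancel_left]
    have h3 := (hd.between_mul_left (b ^ N)).2 h2
    have e3 : b ^ N * b ^ N = a ^ (q * N + q * N) := by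
      rw [hbdef, ← zpow_natCast, ← zpow_mul, ← zpow_add]
    rw [mul_inv_cancel, e3] at h3
    obtain ⟨j, hj⟩ := hR _ _ h3
    refine ⟨j - q * N, ?_⟩
    rw [← hd.mul_left (b ^ N)]
    convert hj using 2
    rw [hbdef, ← zpow_natCast, ← zpow_mul, ← zpow_add]
    congr 1
    ring
  refine ⟨R, fun g p q hp h => ?_⟩
  obtain ⟨p, rfl | rfl⟩ := p.eq_nat_or_neg
  · exact key g p q (by exact_mod_cast hp) (by simpa using h)
  · refine key g p (-q) (by simpa using hp) ?_
    rw [zpow_neg, ← h]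
    simp [mul_assoc]

/-- The commensurator of `⟨a⟩` is abelian: it is torsion-free, and `⟨a⟩` has finite index in it. -/
theorem commute_of_conj_zpow (hd : IsHypMetric d E) (htf : IsTorsionFreeGroup G) {a : G}
    (ha : a ≠ 1) {g h : G} {p q r s : ℤ} (hp : p ≠ 0) (hg : g * a ^ p * g⁻¹ = a ^ q)
    (hr : r ≠ 0) (hh : h * a ^ r * h⁻¹ = a ^ s) : Commute g h := by
  have hne : ∀ {g : G} {p q : ℤ}, p ≠ 0 → g * a ^ p * g⁻¹ = a ^ q → q ≠ 0 := by
    rintro g p q hp hg rfl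
    rw [zpow_zero, mul_inv_eq_one, mul_eq_left] at hg
    exact htf.zpow_ne_one ha hp hg
  let C : Subgroup G :=
    { carrier := {g | ∃ p q : ℤ, p ≠ 0 ∧ g * a ^ p * g⁻¹ = a ^ q}
      one_mem' := ⟨1, 1, one_ne_zero, by simp⟩
      mul_mem' := by
        rintro g h ⟨p, q, hp, hg⟩ ⟨r, s, hr, hh⟩
        refine ⟨r * p, q * s, mul_ne_zero hr hp, ?_⟩
        have h1 : h * a ^ (r * p) * h⁻¹ = a ^ (s * p) := by
          rw [zpow_mul, ← conj_zpow, hh, ← zpow_mul]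
        have h2 : g * a ^ (p * s) * g⁻¹ = a ^ (q * s) := by
          rw [zpow_mul, ← conj_zpow, hg, ← zpow_mul]
        rw [← h2, mul_comm p s, ← h1]
        group
      inv_mem' := by
        rintro g ⟨p, q, hp, hg⟩
        refine ⟨q, p, hne hp hg, ?_⟩
        rw [← hg]
        group }
  have haC : a ∈ C := ⟨1, 1, one_ne_zero, by simp⟩
  obtain ⟨R, hR⟩ := hd.exists_near_of_conj_zpow htf ha
  have hfin : {u : C | d 1 (u : G) ≤ R}.Finite :=
    (hd.finite_ball R).preimage Subtype.val_injective.injOn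
  have : Finite {u : C | d 1 (u : G) ≤ R} := hfin
  have hsurj : Function.Surjective fun u : {u : C | d 1 (u : G) ≤ R} =>
      (QuotientGroup.mk u.1 : C ⧸ Subgroup.zpowers (⟨a, haC⟩ : C)) := by
    intro y
    induction y using QuotientGroup.induction_on with
    | H g =>
      obtain ⟨p, q, hp, hg⟩ := C.inv_mem g.2
      obtain ⟨j, hj⟩ := hR _ p q hp hg
      rw [hd.eq_norm, inv_inv] at hj
      refine ⟨⟨g * (⟨a, haC⟩ : C) ^ j, by simpa using hj⟩, ?_⟩
      rw [QuotientGroup.eq]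
      refine Subgroup.mem_zpowers_iff.2 ⟨-j, ?_⟩
      group
  have := Finite.of_surjective _ hsurj
  have : (Subgroup.zpowers (⟨a, haC⟩ : C)).FiniteIndex := Subgroup.finiteIndex_of_finite_quotient
  have htfC : IsTorsionFreeGroup C := fun u hu =>
    Subtype.ext (htf u (Submonoid.isOfFinOrder_coe.2 hu))
  have := commute_of_finiteIndex_zpowers htfC (⟨a, haC⟩ : C)
    (⟨g, p, q, hp, hg⟩ : C) (⟨h, r, s, hr, hh⟩ : C)
  exact congrArg Subtype.val this

lemma commute_of_conj_zpow_self (hd : IsHypMetric d E) (htf : IsTorsionFreeGroup G) {a : G}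
    (ha : a ≠ 1) {g : G} {p q : ℤ} (hp : p ≠ 0) (hg : g * a ^ p * g⁻¹ = a ^ q) : Commute g a :=
  hd.commute_of_conj_zpow htf ha hp hg one_ne_zero (s := 1) (by simp)

lemma commute_trans (hd : IsHypMetric d E) (htf : IsTorsionFreeGroup G) {a g h : G} (ha : a ≠ 1)
    (hg : Commute g a) (hh : Commute h a) : Commute g h :=
  hd.commute_of_conj_zpow htf ha one_ne_zero (q := 1) (by simp [hg.eq]) one_ne_zero (s := 1)
    (by simp [hh.eq])

lemma exists_near_of_commute (hd : IsHypMetric d E) (htf : IsTorsionFreeGroup G) {a : G}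
    (ha : a ≠ 1) : ∃ R, ∀ g : G, Commute g a → ∃ j : ℤ, d g (a ^ j) ≤ R := by
  obtain ⟨R, hR⟩ := hd.exists_near_of_conj_zpow htf ha
  exact ⟨R, fun g hg => hR g 1 1 one_ne_zero (by simp [hg.eq])⟩

/-! ### Fellow travelling forces commutation -/

/-- If sufficiently many points `g * a ^ l` are within distance `R` of the powers of `b`, then `g`
conjugates a nontrivial power of `a` to a power of `b`. -/
lemma exists_conj_zpow_eq (hd : IsHypMetric d E) (R : ℝ) :
    ∃ n : ℕ, ∀ (a b g : G) (T : Finset ℕ), n < T.card →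
      (∀ l ∈ T, ∃ s : ℤ, d (g * a ^ l) (b ^ s) ≤ R) →
      ∃ p q : ℤ, p ≠ 0 ∧ g * a ^ p * g⁻¹ = b ^ q := by
  classical
  refine ⟨(hd.finite_ball R).toFinset.card, fun a b g T hT h => ?_⟩
  choose! s hs using h
  obtain ⟨i, hi, j, hj, hij, he⟩ := Finset.exists_ne_map_eq_of_card_lt_of_maps_to hT
    (f := fun l => (b ^ s l)⁻¹ * (g * a ^ l)) (by
      intro l hl
      simp only [Set.Finite.coe_toFinset]
      change d 1 _ ≤ R
      rw [← hd.eq_norm, hd.symm]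
      exact hs l hl)
  refine ⟨i - j, s i - s j, by omega, ?_⟩
  rw [inv_mul_eq_iff_eq_mul, ← mul_assoc] at he
  rw [zpow_sub, zpow_sub, zpow_natCast, zpow_natCast, ← mul_assoc, he]
  group

/-- Elements of the centralizer of `a` have a power in `⟨a⟩`. -/
lemma exists_zpow_eq_zpow (hd : IsHypMetric d E) (htf : IsTorsionFreeGroup G) {a g : G}
    (ha : a ≠ 1) (hg : Commute g a) : ∃ p q : ℤ, p ≠ 0 ∧ g ^ p = a ^ q := by
  obtain ⟨R, hR⟩ := hd.exists_near_of_commute htf ha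
  obtain ⟨n, hn⟩ := hd.exists_conj_zpow_eq R
  simpa using hn g a 1 (Finset.range (n + 1)) (by simp)
    (fun l _ => by simpa using hR (g ^ l) (hg.pow_left l))

/-- Roots are unique in the centralizer of a nontrivial element. -/
lemma eq_of_zpow_eq (hd : IsHypMetric d E) (htf : IsTorsionFreeGroup G) {a g h : G} (ha : a ≠ 1)
    (hg : Commute g a) (hh : Commute h a) {k : ℤ} (hk : k ≠ 0) (h1 : g ^ k = h ^ k) : g = h := by
  have hc := hd.commute_trans htf ha hg hh
  by_contra hne
  refine htf.zpow_ne_one (a := g * h⁻¹) (fun h2 => hne (mul_inv_eq_one.1 h2)) hk ?_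
  rw [hc.inv_right.mul_zpow, h1, inv_zpow, mul_inv_cancel]

/-- If `h` does not commute with `a`, then the quasi-rays from `1` through the powers of `a⁻¹` and
through the points `h * a ^ j` diverge. -/
lemma exists_norm_pow_mul_pow (hd : IsHypMetric d E) (htf : IsTorsionFreeGroup G) {a h : G}
    (ha : a ≠ 1) (hh : ¬ Commute h a) :
    ∃ K, ∀ i j : ℕ, d 1 (a ^ i) + d 1 (a ^ j) ≤ d 1 (a ^ i * h * a ^ j) + K := by
  obtain ⟨K₀, hK⟩ := hd.exists_isLox htf ha
  have hK0 := hK.nonneg hd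
  have hE := hd.const_nonneg
  have hh0 := hd.nonneg 1 h
  have ha0 := hd.nonneg 1 a
  obtain ⟨R, hR⟩ := hK.exists_near_pow hd (K' := K₀ + E + 2 * d 1 h) (by linarith)
  obtain ⟨n, hn⟩ := hd.exists_conj_zpow_eq R
  refine ⟨2 * (n * d 1 a) + d 1 h + E, fun i j => ?_⟩
  have hpow : ∀ l ≤ n, d 1 (a ^ l) ≤ n * d 1 a := fun l hl =>
    (hd.norm_pow_le a l).trans (mul_le_mul_of_nonneg_right (by exact_mod_cast hl) ha0)
  by_contra! hcon
  have hni : n < i := by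
    by_contra! hi
    have e1 := hd.norm_le_mul_left (a ^ i * h) (a ^ j)
    have e2 := hd.norm_mul_le (a ^ i) h
    linarith [hpow i hi]
  refine hh ?_
  obtain ⟨p, q, hp, hpq⟩ := hn a⁻¹ a h⁻¹ (Finset.range (n + 1)) (by simp) (by
    intro l hl
    have hln : l ≤ n := Nat.lt_succ_iff.1 (Finset.mem_range.1 hl)
    suffices hB : Between d (K₀ + E) 1 (a⁻¹ ^ l) (h * a ^ j) by
      obtain ⟨s, -, hs⟩ := hR j _ (hd.between_of_mul hB)
      exact ⟨s, by simpa using hs⟩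
    have e1 := (hK.inv hd).between_pow hd (show l ≤ i by omega)
    unfold Between at e1 ⊢
    have e2 : d (a⁻¹ ^ i) (h * a ^ j) = d 1 (a ^ i * h * a ^ j) := by
      rw [hd.eq_norm]; simp [mul_assoc]
    have e3 : d 1 (a⁻¹ ^ i) = d 1 (a ^ i) := by rw [inv_pow, hd.norm_inv]
    have e4 : d 1 (a⁻¹ ^ l) = d 1 (a ^ l) := by rw [inv_pow, hd.norm_inv]
    have e5 := hd.triangle (a⁻¹ ^ l) 1 (h * a ^ j)
    have e6 := hd.symm (a⁻¹ ^ l) 1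
    have e7 := hd.norm_le_mul_left h (a ^ j)
    have e8 := hd.triangle 1 (a⁻¹ ^ l) (h * a ^ j)
    have e9 := hpow l hln
    rcases hd.four 1 (a⁻¹ ^ i) (a⁻¹ ^ l) (h * a ^ j) with h1 | h1
    · linarith
    · linarith [hd.symm (a⁻¹ ^ i) (a⁻¹ ^ l)])
  have hcomm := hd.commute_of_conj_zpow_self htf (a := a) (g := h⁻¹) (p := -p) (q := q) ha
    (by simpa using hp) (by rw [zpow_neg, ← inv_zpow]; exact hpq)
  exact Commute.inv_left_iff.1 hcomm

end IsHypMetric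

/-! ### The quasi-axis of `h * a ^ m` -/

namespace IsLox

variable {G : Type*} [Group G] {d : G → G → ℝ} {E K : ℝ} {y : G}

lemma between_neg_pow (hy : IsLox d K y) (hd : IsHypMetric d E) {K' : ℝ} {q : G}
    (hq : Between d K' 1 q y) {N : ℕ} (hN : 0 < N) :
    Between d (K' + 2 * K) (y ^ N)⁻¹ q (y ^ N) := by
  obtain ⟨N, rfl⟩ := Nat.exists_eq_succ_of_ne_zero hN.ne'
  unfold Between at *
  have e1 := hd.triangle (y ^ (N + 1))⁻¹ 1 q
  rw [hd.symm _ 1, hd.norm_inv] at e1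
  have e2 := hd.triangle q y (y ^ (N + 1))
  rw [hd.eq_norm y, pow_succ', inv_mul_cancel_left, ← pow_succ'] at e2
  have e3 := hy 1 N
  rw [pow_one, add_comm 1 N] at e3
  have e4 := hy (N + 1) (N + 1)
  rw [hd.eq_norm (y ^ (N + 1))⁻¹ (y ^ (N + 1)), inv_inv, ← pow_add]
  linarith

lemma natAbs_mul_le (hy : IsLox d K y) (hd : IsHypMetric d E) (k l : ℤ) :
    (k - l).natAbs * (d 1 y - K) ≤ d (y ^ k) (y ^ l) := by
  have h := hy.le_norm_pow hd (k - l).natAbs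
  have h2 : d (y ^ k) (y ^ l) = d 1 (y ^ (k - l).natAbs) := by
    rcases Int.natAbs_eq (k - l) with h | h
    · rw [hd.symm, hd.eq_norm, ← zpow_natCast, ← h, ← zpow_neg, ← zpow_add]
      congr 2
      ring
    · rw [hd.eq_norm, ← zpow_natCast, ← neg_eq_iff_eq_neg.2 h, ← zpow_neg, ← zpow_add]
      congr 2
      ring
  rwa [h2]

end IsLox

namespace IsHypMetric

variable {G : Type*} [Group G] {d : G → G → ℝ} {E : ℝ}

/-- The powers of `h * a ^ m` form a quasi-geodesic whose error does not depend on `m`. -/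
lemma exists_isLox_mul_pow (hd : IsHypMetric d E) (htf : IsTorsionFreeGroup G) {a h : G}
    (ha : a ≠ 1) (hh : ¬ Commute h a) :
    ∃ K, ∀ C, ∃ m₀ : ℕ, ∀ m ≥ m₀, IsLox d K (h * a ^ m) ∧ C ≤ d 1 (h * a ^ m) := by
  obtain ⟨K, hK⟩ := hd.exists_norm_pow_mul_pow htf ha hh
  refine ⟨K + 3 * d 1 h + 2 * E, fun C => ?_⟩
  obtain ⟨m₀, hm₀⟩ := hd.exists_lt_norm_pow htf ha
    (max C (K + 3 * d 1 h + 2 * E + 1) + d 1 h)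
  refine ⟨m₀, fun m hm => ?_⟩
  have h1 := hm₀ m hm
  have h2 := hd.norm_le_mul_left h (a ^ m)
  have h3 := le_max_left C (K + 3 * d 1 h + 2 * E + 1)
  have h4 := le_max_right C (K + 3 * d 1 h + 2 * E + 1)
  refine ⟨hd.isLox_of_sq ?_ (by linarith), by linarith⟩
  have h5 := hK m m
  have h6 := hd.norm_le_mul_left h (a ^ m * h * a ^ m)
  have h7 : (h * a ^ m) ^ 2 = h * (a ^ m * h * a ^ m) := by
    rw [pow_two]
    simp only [mul_assoc]
  rw [h7]
  linarith [hd.norm_mul_le h (a ^ m)]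

/-- A conjugator `g` from `h * a ^ m` to `h' * a ^ m` maps the quasi-axis of `h' * a ^ m` to that
of `h * a ^ m`. Since both consist of long segments along translates of the axis of `a`, joined by
segments of bounded length, `g` followed by a power of `h * a ^ m` lets two of the long segments
fellow travel, and so commutes with `a`. -/
theorem exists_zpow_mul_of_semiconj (hd : IsHypMetric d E) (htf : IsTorsionFreeGroup G)
    {a h h' : G} (ha : a ≠ 1) (hh : ¬ Commute h a) (hh' : ¬ Commute h' a) :
    ∃ m₀ : ℕ, ∀ m ≥ m₀, ∀ g : G, SemiconjBy g (h' * a ^ m) (h * a ^ m) →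
      ∃ (k : ℤ) (x : G), Commute x a ∧ g = (h * a ^ m) ^ k * x ∧ SemiconjBy x h' h := by
  classical
  obtain ⟨K₀, hK₀⟩ := hd.exists_isLox htf ha
  obtain ⟨Kh, hKh⟩ := hd.exists_isLox_mul_pow htf ha hh
  obtain ⟨Kh', hKh'⟩ := hd.exists_isLox_mul_pow htf ha hh'
  set K := max Kh Kh' with hKdef
  have hE := hd.const_nonneg
  have hK₀0 := hK₀.nonneg hd
  have hhn := hd.nonneg 1 h
  have hhn' := hd.nonneg 1 h'
  have hK0 : 0 ≤ K := by
    obtain ⟨m, hm⟩ := hKh 0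
    exact ((hm m le_rfl).1.nonneg hd).trans (le_max_left _ _)
  set K₂ := K₀ + 2 * d 1 h' + 2 * K with hK₂
  set K₄ := 4 * K + 4 * (K₂ + 2 * E) + 2 * E with hK₄
  obtain ⟨R, hR⟩ := hK₀.exists_near_pow hd (K' := K₄ + 2 * d 1 h) (by linarith)
  obtain ⟨n, hn⟩ := hd.exists_conj_zpow_eq R
  obtain ⟨m₁, hm₁⟩ := hKh (5 * K + 3 * K₀ + 5 * d 1 h + 2 * |R| + 1)
  obtain ⟨m₂, hm₂⟩ := hKh' 0
  refine ⟨max (9 * n) (max m₁ m₂), fun m hm g hg => ?_⟩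
  have hmn : 9 * n ≤ m := (le_max_left _ _).trans hm
  obtain ⟨hy, hyC⟩ := hm₁ m ((le_max_left _ _).trans ((le_max_right _ _).trans hm))
  obtain ⟨hy', -⟩ := hm₂ m ((le_max_right _ _).trans ((le_max_right _ _).trans hm))
  replace hy := hy.mono (le_max_left Kh Kh')
  replace hy' := hy'.mono (le_max_right Kh Kh')
  rw [← hKdef] at hy hy'
  have hyh := hd.norm_mul_le h (a ^ m)
  have hyh' := hd.norm_le_mul_left h (a ^ m)
  set y := h * a ^ m with hydef
  set y' := h' * a ^ m with hydef'
  have habsR := abs_nonneg R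
  have hy1 : y ≠ 1 := by
    intro h1
    rw [h1, hd.self] at hyC
    linarith
  -- Each point `g * h' * a ^ j` of the image axis is close to a point of the axis of `y`.
  have near : ∀ j ≤ m, ∃ k : ℤ, ∃ i ≤ m,
      d (h⁻¹ * (y ^ k)⁻¹ * g * h' * a ^ j) (a ^ i) ≤ R := by
    intro j hj
    have h1 : Between d (K₀ + 2 * d 1 h') 1 (h' * a ^ j) y' := by
      have e1 := hK₀.between_pow hd hj
      unfold Between at e1 ⊢
      rw [hydef', hd.mul_left]
      linarith [hd.norm_mul_le h' (a ^ j), hd.norm_le_mul_left h' (a ^ m)]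
    set p := g * (h' * a ^ j) with hp
    obtain ⟨N, hN⟩ := hd.exists_lt_norm_pow htf hy1 (d 1 g + K₂ + 2 * E + d 1 p)
    have hN := hN (N + 1) (by omega)
    have h2 := hy'.between_neg_pow hd h1 (N := N + 1) (by omega)
    have h3 := (hd.between_mul_left g).2 h2
    rw [(hg.pow_right (N + 1)).inv_right.eq, (hg.pow_right (N + 1)).eq, ← hp, ← hK₂] at h3
    set z := y ^ (N + 1) with hz
    have h4 : Between d (K₂ + 2 * E) z⁻¹ p z := by
      have e1 := hd.triangle z⁻¹ p 1
      rw [hd.symm z⁻¹ 1, hd.norm_inv, hd.symm p 1] at e1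
      have e2 := hd.triangle 1 p z
      refine hd.between_of_close_ends (C := d 1 g) h3 ?_ ?_ (by linarith) (by linarith) <;>
        rw [hd.eq_norm, inv_mul_cancel_left]
    have h5 := (hd.between_mul_left z).2 h4
    have hzz : z * z = y ^ (N + 1 + (N + 1)) := by rw [hz, ← pow_add]
    rw [mul_inv_cancel, hzz] at h5
    obtain ⟨l, -, hl⟩ := hd.exists_between_succ hK0 (K' := K₂ + 2 * E) (by linarith)
      (fun j => y ^ j)
      (n := N + 1 + (N + 1)) (by omega) (fun j hj => by simpa using hy.between_pow hd hj)
      (p := z * p) (by simpa using h5)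
    have h6 := (hd.between_mul_left (y ^ l)⁻¹).2 hl
    rw [inv_mul_cancel, pow_succ, inv_mul_cancel_left] at h6
    obtain ⟨i, hi, hi2⟩ := hR m _ (hd.between_of_mul h6)
    refine ⟨(l : ℤ) - (N + 1 : ℕ), i, hi, ?_⟩
    convert hi2 using 1
    rw [zpow_sub, zpow_natCast, zpow_natCast, ← hz, hp]
    congr 1
    simp only [mul_inv_rev, inv_inv, mul_assoc]
    congr 1
    rw [← mul_assoc, ← mul_assoc (y ^ l)⁻¹]
    congr 1
    rw [hz]
    exact ((Commute.pow_pow_self y (N + 1) l).inv_right).eq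
  choose! k i hi hk using near
  -- The segments of the image axis have about the length of a period of the axis of `y`, so they
  -- meet boundedly many periods.
  have hrange : ∀ j ≤ m, (k j - k 0).natAbs ≤ 4 := by
    intro j hj
    by_contra! hcon
    have hclose : ∀ j ≤ m, d (g * (h' * a ^ j)) (y ^ k j) ≤ R + d 1 h + d 1 (a ^ m) + K₀ := by
      intro j hj
      have e1 : d (h⁻¹ * (y ^ k j)⁻¹ * g * h' * a ^ j) (a ^ i j) =
          d (g * (h' * a ^ j)) (y ^ k j * (h * a ^ i j)) := by
        rw [← hd.mul_left (y ^ k j * h)]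
        congr 1 <;> group
      have e2 := hd.triangle (g * (h' * a ^ j)) (y ^ k j * (h * a ^ i j)) (y ^ k j)
      rw [hd.symm (y ^ k j * (h * a ^ i j)) (y ^ k j), hd.eq_norm (y ^ k j) (y ^ k j * _),
        inv_mul_cancel_left] at e2
      linarith [hk j hj, hd.norm_mul_le h (a ^ i j), hK₀.norm_pow_le hd (hi j hj)]
    have e1 := hclose j hj
    have e2 := hclose 0 (Nat.zero_le _)
    have e3 : d (g * (h' * a ^ 0)) (g * (h' * a ^ j)) ≤ d 1 (a ^ m) + K₀ := by
      rw [hd.mul_left, hd.mul_left, pow_zero]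
      exact hK₀.norm_pow_le hd hj
    have e4 := hd.triangle (y ^ k j) (g * (h' * a ^ j)) (y ^ k 0)
    have e5 := hd.triangle (g * (h' * a ^ j)) (g * (h' * a ^ 0)) (y ^ k 0)
    rw [hd.symm (g * (h' * a ^ j)) (g * (h' * a ^ 0))] at e5
    rw [hd.symm (y ^ k j) (g * (h' * a ^ j))] at e4
    have e6 := hy.natAbs_mul_le hd (k j) (k 0)
    have e7 : (5 : ℝ) ≤ (k j - k 0).natAbs := by exact_mod_cast hcon
    have e8 : 0 ≤ d 1 y - K := by linarith
    have e9 := mul_le_mul_of_nonneg_right e7 e8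
    linarith [le_abs_self R]
  obtain ⟨k₀, -, hk₀⟩ := Finset.exists_lt_card_fiber_of_mul_lt_card_of_maps_to
    (s := Finset.range (m + 1)) (t := Finset.Icc (k 0 - 4) (k 0 + 4)) (f := k) (n := n)
    (by
      intro j hj
      have := hrange j (Nat.lt_succ_iff.1 (Finset.mem_range.1 hj))
      rw [Finset.mem_Icc]
      omega)
    (by
      rw [Int.card_Icc, Finset.card_range]
      have : (k 0 + 4 + 1 - (k 0 - 4)).toNat = 9 := by omega
      rw [this]
      omega)
  obtain ⟨p, q, hp, hpq⟩ := hn a a (h⁻¹ * (y ^ k₀)⁻¹ * g * h') _ hk₀ (by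
    intro l hl
    rw [Finset.mem_filter, Finset.mem_range] at hl
    have := hk l (by omega)
    rw [hl.2] at this
    exact ⟨i l, by simpa using this⟩)
  have hx := hd.commute_of_conj_zpow_self htf ha hp hpq
  set x := h⁻¹ * (y ^ k₀)⁻¹ * g * h' with hxdef
  have hgx : (y ^ k₀)⁻¹ * g = h * x * h'⁻¹ := by rw [hxdef]; group
  have hconj : SemiconjBy ((y ^ k₀)⁻¹ * g) y' y :=
    SemiconjBy.mul_left (Commute.zpow_self y k₀).inv_left hg
  have hxx : x = h * x * h'⁻¹ := by
    have e1 : h * x * h'⁻¹ * (h' * a ^ m) = h * a ^ m * (h * x * h'⁻¹) := by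
      rw [← hgx]
      exact hconj.eq
    have e2 : h * (x * a ^ m) = h * (a ^ m * (h * x * h'⁻¹)) := by
      rw [← mul_assoc h (a ^ m), ← e1]
      group
    have e3 := mul_left_cancel e2
    rw [(hx.pow_right m).eq] at e3
    exact mul_left_cancel e3
  refine ⟨k₀, x, hx, ?_, ?_⟩
  · rw [hxx, ← hgx, mul_inv_cancel_left]
  · exact mul_inv_eq_iff_eq_mul.1 hxx.symm |>.symm

/-- For large `m` no element `(h * a ^ m) ^ k * x` with `k ≠ 0` commutes with `b`. Otherwise it would
lie near the quasi-axis of `b`, while the path from `1` to it or to its inverse starts with a long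
segment along the axis of `a`; the axes of `a` and `b` would fellow travel. -/
lemma exists_not_commute_zpow_mul (hd : IsHypMetric d E) (htf : IsTorsionFreeGroup G)
    {a b h x : G} (hab : ¬ Commute a b) (hh : ¬ Commute h a) (hx : Commute x a) :
    ∃ m₀ : ℕ, ∀ m ≥ m₀, ∀ k : ℤ, k ≠ 0 → ¬ Commute ((h * a ^ m) ^ k * x) b := by
  have ha : a ≠ 1 := fun h => hab (h ▸ Commute.one_left b)
  have hb : b ≠ 1 := fun h => hab (h ▸ Commute.one_right a)
  obtain ⟨K₀, hK₀⟩ := hd.exists_isLox htf ha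
  obtain ⟨Kb, hKb⟩ := hd.exists_isLox htf hb
  obtain ⟨K, hK⟩ := hd.exists_isLox_mul_pow htf ha hh
  obtain ⟨Rb, hRb⟩ := hd.exists_near_of_commute htf hb
  have hK₀0 := hK₀.nonneg hd
  have hK0 : 0 ≤ K := by
    obtain ⟨m, hm⟩ := hK 0
    exact (hm m le_rfl).1.nonneg hd
  have hhn := hd.nonneg 1 h
  have hxn := hd.nonneg 1 x
  set K' := K + K₀ + 2 * d 1 h with hK'
  obtain ⟨R, hR⟩ := hKb.exists_near_zpow hd (K' := K' + 2 * d 1 x + 2 * |Rb|) (by positivity)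
  obtain ⟨n, hn⟩ := hd.exists_conj_zpow_eq R
  obtain ⟨m₁, hm₁⟩ := hK 0
  refine ⟨max n m₁, fun m hm k hk hcomm => ?_⟩
  have hmn : n ≤ m := (le_max_left _ _).trans hm
  obtain ⟨hy, -⟩ := hm₁ m ((le_max_right _ _).trans hm)
  have hyh := hd.norm_le_mul_left h (a ^ m)
  set y := h * a ^ m with hydef
  have follow : ∀ r : ℕ, 0 < r → ∀ j ≤ m, Between d K' 1 (a⁻¹ ^ j) (y⁻¹ ^ r) := by
    intro r hr j hj
    obtain ⟨r, rfl⟩ := Nat.exists_eq_succ_of_ne_zero hr.ne'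
    have e1 := hd.triangle (a⁻¹ ^ j) y⁻¹ (y⁻¹ ^ (r + 1))
    rw [hd.eq_norm y⁻¹, pow_succ' y⁻¹, inv_mul_cancel_left, ← pow_succ', inv_pow y r,
      hd.norm_inv] at e1
    have e2 : d (a⁻¹ ^ j) y⁻¹ = d 1 (h * a ^ (m - j)) := by
      rw [hd.symm, hd.eq_norm, inv_inv, hydef, mul_assoc, inv_pow]
      congr 2
      rw [mul_inv_eq_iff_eq_mul, ← pow_add, Nat.sub_add_cancel hj]
    have e3 := hK₀ j (m - j)
    rw [Nat.add_sub_cancel' hj] at e3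
    have e4 := hy 1 r
    rw [pow_one, add_comm 1 r] at e4
    have e5 : d 1 (y⁻¹ ^ (r + 1)) = d 1 (y ^ (r + 1)) := by rw [inv_pow, hd.norm_inv]
    have e6 : d 1 (a⁻¹ ^ j) = d 1 (a ^ j) := by rw [inv_pow, hd.norm_inv]
    have e7 := hd.norm_mul_le h (a ^ (m - j))
    unfold Between
    linarith
  have contra : ∀ u s : G, Commute u a → Commute s b →
      (∀ j ≤ m, Between d (K' + 2 * d 1 x) 1 (u * a⁻¹ ^ j) s) → False := by
    intro u s hu hs hB
    obtain ⟨t, ht⟩ := hRb s hs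
    obtain ⟨p, q, hp, hpq⟩ := hn a⁻¹ b u (Finset.range (n + 1)) (by simp) (by
      intro l hl
      have hlm : l ≤ m := (Nat.lt_succ_iff.1 (Finset.mem_range.1 hl)).trans hmn
      refine hR t _ ?_
      have e1 := hB l hlm
      unfold Between at e1 ⊢
      have e2 := hd.triangle (u * a⁻¹ ^ l) s (b ^ t)
      have e3 := hd.triangle 1 (b ^ t) s
      rw [hd.symm (b ^ t) s] at e3
      linarith [le_abs_self Rb])
    rw [(hu.inv_right.zpow_right p).eq, mul_inv_cancel_right, inv_zpow, ← zpow_neg] at hpq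
    refine hab (hd.commute_of_conj_zpow_self htf ha (p := -p) (q := -p) (by simpa using hp)
      ?_).symm
    rw [hpq]
    simp [(Commute.self_zpow b q).eq]
  obtain ⟨r, rfl | rfl⟩ := k.eq_nat_or_neg
  · have hr : 0 < r := Nat.pos_of_ne_zero (by exact_mod_cast hk)
    refine contra x⁻¹ (x⁻¹ * y⁻¹ ^ r) hx.inv_left ?_ fun j hj => ?_
    · have := hcomm.inv_left
      rwa [mul_inv_rev, zpow_natCast, ← inv_pow] at this
    · have e1 := (hd.between_mul_left x⁻¹).2 (follow r hr j hj)
      unfold Between at e1 ⊢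
      rw [mul_one] at e1
      have e2 := hd.triangle 1 x⁻¹ (x⁻¹ * a⁻¹ ^ j)
      have e3 := hd.triangle x⁻¹ 1 (x⁻¹ * y⁻¹ ^ r)
      rw [hd.symm x⁻¹ 1] at e3
      rw [hd.norm_inv] at e2 e3
      linarith
  · have hr : 0 < r := Nat.pos_of_ne_zero (by simpa using hk)
    refine contra 1 (y⁻¹ ^ r * x) (Commute.one_left a) ?_ fun j hj => ?_
    · rwa [zpow_neg, zpow_natCast, ← inv_pow] at hcomm
    · have e1 := follow r hr j hj
      unfold Between at e1 ⊢
      rw [one_mul]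
      have e2 := hd.triangle (a⁻¹ ^ j) (y⁻¹ ^ r) (y⁻¹ ^ r * x)
      rw [hd.eq_norm (y⁻¹ ^ r), inv_mul_cancel_left] at e2
      linarith [hd.norm_le_mul_right (y⁻¹ ^ r) x]

end IsHypMetric

/-! ### Pointwise conjugations are conjugations -/

section Pointwise

variable {G : Type*} [Group G] {d : G → G → ℝ} {E : ℝ} {H : Subgroup G} {φ : H →* G}

lemma eq_one_of_map_eq_one (hφ : ∀ h : H, IsConj (h : G) (φ h)) {h : H} (h1 : φ h = 1) :
    h = 1 := by
  have := hφ h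
  rw [h1] at this
  exact Subtype.ext (isConj_one_left.1 this)

lemma map_commute_iff (hφ : ∀ h : H, IsConj (h : G) (φ h)) {g h : H} :
    Commute (φ g) (φ h) ↔ Commute (g : G) (h : G) := by
  have hinj : Function.Injective φ :=
    (injective_iff_map_eq_one φ).2 fun h h1 => eq_one_of_map_eq_one hφ h1
  unfold Commute SemiconjBy
  rw [← map_mul, ← map_mul, hinj.eq_iff, Subtype.ext_iff]
  rfl

lemma map_eq_self_of_commute (hd : IsHypMetric d E) (htf : IsTorsionFreeGroup G)
    (hφ : ∀ h : H, IsConj (h : G) (φ h)) {a : H} (ha : (a : G) ≠ 1) (hφa : φ a = a) {h : H}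
    (hh : Commute (h : G) a) : φ h = h := by
  obtain ⟨p, q, hp, hpq⟩ := hd.exists_zpow_eq_zpow htf ha hh
  have h1 : Commute (φ h) a := by
    rw [← hφa]
    exact (map_commute_iff hφ).2 hh
  refine hd.eq_of_zpow_eq htf ha h1 hh hp ?_
  have h2 : h ^ p = a ^ q := Subtype.ext (by simpa using hpq)
  rw [← map_zpow, h2, map_zpow, hφa, hpq]

/-- A pointwise conjugation `φ` that fixes `a` maps every `h` to its conjugate by some element of
the centralizer of `a`; this element may depend on `h`. -/
lemma exists_commute_conj (hd : IsHypMetric d E) (htf : IsTorsionFreeGroup G)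
    (hφ : ∀ h : H, IsConj (h : G) (φ h)) {a : H} (ha : (a : G) ≠ 1) (hφa : φ a = a) (h : H) :
    ∃ x : G, Commute x a ∧ SemiconjBy x (φ h) h := by
  by_cases hh : Commute (h : G) a
  · exact ⟨1, Commute.one_left _, by
      rw [map_eq_self_of_commute hd htf hφ ha hφa hh]; exact SemiconjBy.one_left _⟩
  · have hh' : ¬ Commute (φ h) a := fun hc => hh (by
      rw [← hφa] at hc
      exact (map_commute_iff hφ).1 hc)
    obtain ⟨m, hm⟩ := hd.exists_zpow_mul_of_semiconj htf ha hh hh'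
    obtain ⟨c, hc⟩ := isConj_iff.1 (hφ (h * a ^ m))
    have hg : SemiconjBy c⁻¹ (φ h * (a : G) ^ m) (h * (a : G) ^ m) := by
      rw [map_mul, map_pow, hφa] at hc
      rw [← hc]
      unfold SemiconjBy
      push_cast
      group
    obtain ⟨-, x, hx, -, hxh⟩ := hm m le_rfl _ hg
    exact ⟨x, hx, hxh⟩

/-- A pointwise conjugation `φ` that fixes two noncommuting elements `a` and `b` is the identity:
for `h` in general position, `h * a ^ m` is conjugate to `φ h * a ^ m` by an element of the
centralizer of `b`; for large `m` this conjugator can only be the one that centralizes `a`. -/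
lemma map_eq_self_of_not_commute (hd : IsHypMetric d E) (htf : IsTorsionFreeGroup G)
    (hφ : ∀ h : H, IsConj (h : G) (φ h)) {a b : H} (hab : ¬ Commute (a : G) b) (hφa : φ a = a)
    (hφb : φ b = b) (h : H) : φ h = h := by
  have ha : (a : G) ≠ 1 := fun h => hab (h ▸ Commute.one_left _)
  have hb : (b : G) ≠ 1 := fun h => hab (h ▸ Commute.one_right _)
  by_cases hh : Commute (h : G) a
  · exact map_eq_self_of_commute hd htf hφ ha hφa hh
  have hh' : ¬ Commute (φ h) a := fun hc => hh (by
    rw [← hφa] at hc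
    exact (map_commute_iff hφ).1 hc)
  obtain ⟨x, hx, hxh⟩ := exists_commute_conj hd htf hφ ha hφa h
  obtain ⟨m₁, hm₁⟩ := hd.exists_zpow_mul_of_semiconj htf ha hh hh'
  obtain ⟨m₂, hm₂⟩ := hd.exists_not_commute_zpow_mul htf hab hh hx
  set m := max m₁ m₂ with hm
  obtain ⟨g, hg, hgh⟩ := exists_commute_conj hd htf hφ hb hφb (h * a ^ m)
  rw [map_mul, map_pow, hφa] at hgh
  obtain ⟨k, x', hx', hgx, hxh'⟩ := hm₁ m (le_max_left _ _) g (by simpa using hgh)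
  -- The conjugator in the centralizer of `a` is unique, since `h` does not commute with `a`.
  have hxx : x' = x := by
    by_contra hne
    have h1 : x' * x⁻¹ ≠ 1 := fun h => hne (mul_inv_eq_one.1 h)
    have h2 : Commute (x' * x⁻¹) (h : G) := SemiconjBy.mul_left hxh' hxh.inv_symm_left
    exact hh (hd.commute_trans htf h1 h2.symm (hx'.mul_left hx.inv_left).symm)
  subst hxx
  have hk : k = 0 := by
    by_contra hk
    exact hm₂ m (le_max_right _ _) k hk (hgx ▸ hg)
  rw [hk, zpow_zero, one_mul] at hgx
  subst hgx
  have hg1 : g = 1 := by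
    by_contra hne
    exact hab (hd.commute_trans htf hne hx'.symm hg.symm)
  have := hxh.eq
  rwa [hg1, one_mul, mul_one] at this

/-- In a torsion-free hyperbolic group, a homomorphism on a subgroup that maps every element to a
conjugate is the restriction of an inner automorphism. -/
theorem exists_conj_of_forall_isConj (hd : IsHypMetric d E) (htf : IsTorsionFreeGroup G)
    (hφ : ∀ h : H, IsConj (h : G) (φ h)) : ∃ c : G, ∀ h : H, φ h = c⁻¹ * h * c := by
  have hconj : ∀ c : G, ∀ h : H, IsConj (h : G) (((MulAut.conj c).toMonoidHom.comp φ) h) :=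
    fun c h => (hφ h).trans (isConj_iff.2 ⟨c, rfl⟩)
  by_cases htriv : ∀ h : H, h = 1
  · exact ⟨1, fun h => by rw [htriv h]; simp⟩
  push Not at htriv
  obtain ⟨a, ha⟩ := htriv
  have ha' : (a : G) ≠ 1 := fun h => ha (Subtype.ext h)
  obtain ⟨c, hc⟩ := isConj_iff.1 (hφ a)
  have hφa : ((MulAut.conj c⁻¹).toMonoidHom.comp φ) a = a := by
    simp only [MonoidHom.comp_apply, MulEquiv.toMonoidHom_eq_coe, MonoidHom.coe_coe,
      MulAut.conj_apply]
    rw [← hc]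
    group
  by_cases hcomm : ∀ h : H, Commute (h : G) a
  · refine ⟨c⁻¹, fun h => ?_⟩
    have := map_eq_self_of_commute hd htf (hconj c⁻¹) ha' hφa (hcomm h)
    simp only [MonoidHom.comp_apply, MulEquiv.toMonoidHom_eq_coe, MonoidHom.coe_coe,
      MulAut.conj_apply] at this
    rw [← this]
    group
  push Not at hcomm
  obtain ⟨b, hb⟩ := hcomm
  obtain ⟨x, hx, hxb⟩ := exists_commute_conj hd htf (hconj c⁻¹) ha' hφa b
  simp only [MonoidHom.comp_apply, MulEquiv.toMonoidHom_eq_coe, MonoidHom.coe_coe,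
    MulAut.conj_apply] at hxb hφa
  refine ⟨x * c⁻¹, fun h => ?_⟩
  have := map_eq_self_of_not_commute hd htf (hconj (x * c⁻¹)) (a := a) (b := b)
    (fun h => hb h.symm) (by
      simp only [MonoidHom.comp_apply, MulEquiv.toMonoidHom_eq_coe, MonoidHom.coe_coe,
        MulAut.conj_apply]
      have h1 : x * c⁻¹ * φ a * (x * c⁻¹)⁻¹ = x * (c⁻¹ * φ a * c⁻¹⁻¹) * x⁻¹ := by group
      rw [h1, hφa, hx.eq, mul_inv_cancel_right]) (by
      simp only [MonoidHom.comp_apply, MulEquiv.toMonoidHom_eq_coe, MonoidHom.coe_coe,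
        MulAut.conj_apply]
      have h1 : x * c⁻¹ * φ b * (x * c⁻¹)⁻¹ = x * (c⁻¹ * φ b * c⁻¹⁻¹) * x⁻¹ := by group
      rw [h1, hxb.eq, mul_inv_cancel_right]) h
  simp only [MonoidHom.comp_apply, MulEquiv.toMonoidHom_eq_coe, MonoidHom.coe_coe,
    MulAut.conj_apply] at this
  rw [← this]
  group

end Pointwise

end HypGroup

theorem mainTheorem2 {G : Type*} [Group G]
    (hG : HypGroup.IsHyperbolicGroup G) (htf : HypGroup.IsTorsionFreeGroup G)
    (H₁ H₂ : Subgroup G) (hret : HypGroup.IsRetract H₁)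
    (hconj : HypGroup.IsElementwiseConjInto H₂ H₁) :
    HypGroup.IsConjInto H₂ H₁ := by
  obtain ⟨S, hfin, hS, δ, -, hδ⟩ := hG
  obtain ⟨f, -, hf⟩ := hret
  have hd := HypGroup.isHypMetric_wordDist hfin hS hδ
  have hφ : ∀ h : H₂, IsConj (h : G) ((H₁.subtype.comp (f.comp H₂.subtype)) h) := by
    intro h
    obtain ⟨b, hb, hhb⟩ := hconj h h.2
    have h1 : IsConj ((f h : H₁) : G) ((f b : H₁) : G) := 
      H₁.subtype.map_isConj (f.map_isConj hhb)
    have h2 : f b = ⟨b, hb⟩ := hf ⟨b, hb⟩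
    rw [h2] at h1
    exact hhb.trans h1.symm
  obtain ⟨c, hc⟩ := HypGroup.exists_conj_of_forall_isConj hd htf hφ
  refine ⟨c, fun a ha => ?_⟩
  rw [← hc ⟨a, ha⟩]
  exact (f a).2
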